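/- **Definitions.** A bornology on a set $X$ is a family of subsets (called bounded) that contains $\emptyset$ and all singletons and is closed under subsets and finite unions. A coarse proximity on $(X,\mathcal B)$ is a relation $\mathbf b$ on the power set of $X$ such that for all $A,B,C\subseteq X$: (i) $A\,\mathbf b\,B$ implies $B\,\mathbf b\,A$; (ii) $A\,\mathbf b\,B$ implies $A,B\notin\mathcal B$; (iii) $A\cap B\notin\mathcal B$ implies $A\,\mathbf b\,B$; (iv) $(A\cup B)\,\mathbf b\,C$ if and only if $A\,\mathbf b\,C$ or $B\,\mathbf b\,C$; (v) if $A\,\bar{\mathbf b}\,B$ (that is, not $A\,\mathbf b\,B$), then there is $E\subseteq X$ with $A\,\bar{\mathbf b}\,E$ and $(X\setminus E)\,\bar{\mathbf b}\,B$. The triple $(X,\mathcal B,\mathbf b)$ is then a coarse proximity space. Its discrete extension is the separated proximity $\delta$ on $X$ given by $A\,\delta\,B$ if and only if $A\cap B\neq\emptyset$ or $A\,\mathbf b\,B$. A cluster is a family $\sigma$ of subsets of $X$ such that any two members of $\sigma$ are $\delta$-near, every $A\subseteq X$ that is $\delta$-near to all members of $\sigma$ belongs to $\sigma$, and $A\cup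 B\in\sigma$ implies $A\in\sigma$ or $B\in\sigma$. The Smirnov compactification $\mathfrak X$ of $(X,\delta)$ is the set of all clusters with the topology induced by the proximity $\delta^*$, where $\mathcal A\,\delta^*\,\mathcal C$ if and only if $A\,\delta\,C$ whenever $A$ belongs to every cluster in $\mathcal A$ and $C$ belongs to every cluster in $\mathcal C$; $X$ is embedded in $\mathfrak X$ by $x\mapsto\{A\subseteq X:\{x\}\,\delta\,A\}$. The boundary $\mathcal UX\subseteq\mathfrak X$ is the subspace of clusters all of whose members are unbounded, and the trace of $A\subseteq X$ is $A'=\mathrm{cl}_{\mathfrak X}(A)\cap\mathcal UX$. **Proposition (boundary stitching).** Let $(X,\mathcal B_X,\mathbf b_X)$ and $(Y,\mathcal B_Y,\mathbf b_Y)$ be coarse proximity spaces and let $g:\mathcal UY\to\mathcal UX$ be a homeomorphism. Let $\mathcal B_{X\sqcup Y}$ be the bornology of all subsets of the disjoint union $X\sqcup Y$ that are contained in a finite union of sets from $\mathcal B_X$ and $\mathcal B_Y$. For $A\subseteq X\sqcup Y$ let $A'_X\subseteq\mathcal UX$ be the trace of $A\cap X$ and $A'_Y\subseteq\mathcal UY$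 the trace of $A\cap Y$. For $A,B\subseteq X\sqcup Y$ let $A\,\mathbf b_g\,B$ hold if and only if $A$ and $B$ are both unbounded and $$[A'_X\cup g(A'_Y)]\cap[B'_X\cup g(B'_Y)]\neq\emptyset .$$ Then: 1. $(X\sqcup Y,\mathcal B_{X\sqcup Y},\mathbf b_g)$ is a coarse proximity space; 2. its boundary $\mathcal U(X\sqcup Y)$ is homeomorphic to $\mathcal UX$. -/

import Mathlib

/-- A coarse proximity `b` on the power set of a set `X` with a bornology.
A set with a bornology and a coarse proximity is a coarse proximity space. -/
structure IsCoarseProximity {X : Type*} [Bornology X] (b : Set X → Set X → Prop) : Prop where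
  symm : ∀ A B, b A B → b B A
  unbounded : ∀ A B, b A B → ¬ Bornology.IsBounded A ∧ ¬ Bornology.IsBounded B
  of_inter : ∀ A B, ¬ Bornology.IsBounded (A ∩ B) → b A B
  union_left : ∀ A B C, b (A ∪ B) C ↔ b A C ∨ b B C
  strong : ∀ A B, ¬ b A B → ∃ E : Set X, ¬ b A E ∧ ¬ b Eᶜ B

/-- A separated (Efremovič) proximity `δ` on the power set of `X`. -/
structure IsSeparatedProximity {X : Type*} (δ : Set X → Set X → Prop) : Prop where
  symm : ∀ A B, δ A B → δ B A
  nonempty : ∀ A B, δ A B → A.Nonempty ∧ B.Nonempty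
  of_inter : ∀ A B, (A ∩ B).Nonempty → δ A B
  union_left : ∀ A B C, δ (A ∪ B) C ↔ δ A C ∨ δ B C
  strong : ∀ A B, ¬ δ A B → ∃ E : Set X, ¬ δ A E ∧ ¬ δ Eᶜ B
  separated : ∀ x y : X, δ {x} {y} → x = y

/-- A cluster for a relation `δ` on the power set of `X`. -/
structure IsCluster {X : Type*} (δ : Set X → Set X → Prop) (σ : Set (Set X)) : Prop where
  near : ∀ A ∈ σ, ∀ B ∈ σ, δ A B
  mem_of_near : ∀ A, (∀ C ∈ σ, δ A C) → A ∈ σ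
  union : ∀ A B, A ∪ B ∈ σ → A ∈ σ ∨ B ∈ σ

theorem IsSeparatedProximity.mono_left {X : Type*} {δ : Set X → Set X → Prop}
    (hδ : IsSeparatedProximity δ) {A B C : Set X} (hAB : A ⊆ B) (h : δ A C) : δ B C := by
  rw [← Set.union_eq_self_of_subset_left hAB]
  exact (hδ.union_left A B C).2 (Or.inl h)

theorem IsCluster.mem_of_subset {X : Type*} {δ : Set X → Set X → Prop} {σ : Set (Set X)}
    (hσ : IsCluster δ σ) (hδ : IsSeparatedProximity δ) {A B : Set X} (hA : A ∈ σ)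
    (hAB : A ⊆ B) : B ∈ σ :=
  hσ.mem_of_near B fun C hC => hδ.mono_left hAB (hσ.near A hA C hC)

/-- The underlying set of the Smirnov compactification of the proximity space `(X, δ)`:
the points are the clusters. -/
@[ext]
structure Smirnov {X : Type*} {δ : Set X → Set X → Prop} (hδ : IsSeparatedProximity δ) where
  sets : Set (Set X)
  isCluster : IsCluster δ sets

namespace Smirnov

/-- `A ⊆ X` absorbs a set `𝒜` of clusters if `A` belongs to every cluster in `𝒜`. -/
def Absorbs {X : Type*} {δ : Set X → Set X → Prop} {hδ : IsSeparatedProximity δ}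
    (A : Set X) (𝒜 : Set (Smirnov hδ)) : Prop :=
  ∀ σ ∈ 𝒜, A ∈ σ.sets

/-- The proximity `δ*` of the Smirnov compactification. -/
def Near {X : Type*} {δ : Set X → Set X → Prop} {hδ : IsSeparatedProximity δ}
    (𝒜 ℬ : Set (Smirnov hδ)) : Prop :=
  ∀ A B : Set X, Absorbs A 𝒜 → Absorbs B ℬ → δ A B

theorem near_singleton_iff {X : Type*} {δ : Set X → Set X → Prop}
    {hδ : IsSeparatedProximity δ} (σ : Smirnov hδ) (ℬ : Set (Smirnov hδ)) :
    Near {σ} ℬ ↔ ∀ B : Set X, Absorbs B ℬ → B ∈ σ.sets := by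
  constructor
  · intro h B hB
    refine σ.isCluster.mem_of_near B fun C hC => hδ.symm _ _ (h C B ?_ hB)
    rintro τ rfl
    exact hC
  · intro h A B hA hB
    exact σ.isCluster.near A (hA σ rfl) B (h B hB)

/-- The topology induced by the proximity `δ*`: a set `F` is closed if and only if it
contains every point `σ` with `{σ} δ* F`. -/
instance instTopologicalSpace {X : Type*} {δ : Set X → Set X → Prop}
    (hδ : IsSeparatedProximity δ) : TopologicalSpace (Smirnov hδ) where
  IsOpen U := ∀ σ ∈ U, ¬ Near {σ} Uᶜ
  isOpen_univ := by
    intro σ _ h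
    rw [near_singleton_iff] at h
    have h0 : (∅ : Set X) ∈ σ.sets := h ∅ (by intro τ hτ; simp at hτ)
    exact Set.not_nonempty_empty (hδ.nonempty _ _ (σ.isCluster.near _ h0 _ h0)).1
  isOpen_inter := by
    intro U V hU hV σ hσ h
    have hU' := hU σ hσ.1
    have hV' := hV σ hσ.2
    rw [near_singleton_iff] at h hU' hV'
    push Not at hU' hV'
    obtain ⟨A, hA, hAσ⟩ := hU'
    obtain ⟨B, hB, hBσ⟩ := hV'
    have hAB : A ∪ B ∈ σ.sets := by
      refine h _ fun τ hτ => ?_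
      rw [Set.compl_inter] at hτ
      rcases hτ with hτ | hτ
      · exact τ.isCluster.mem_of_subset hδ (hA τ hτ) Set.subset_union_left
      · exact τ.isCluster.mem_of_subset hδ (hB τ hτ) Set.subset_union_right
    exact (σ.isCluster.union A B hAB).elim hAσ hBσ
  isOpen_sUnion := by
    rintro S hS σ ⟨U, hUS, hσU⟩ h
    refine hS U hUS σ hσU fun A B hA hB => h A B hA fun τ hτ => hB τ fun hτU => ?_
    exact hτ ⟨U, hUS, hτU⟩

/-- The canonical map `x ↦ {A | {x} δ A}` of `X` into its Smirnov compactification. -/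
def point {X : Type*} {δ : Set X → Set X → Prop} (hδ : IsSeparatedProximity δ) (x : X) :
    Smirnov hδ where
  sets := {A | δ {x} A}
  isCluster := by
    have key : ∀ C D, δ {x} C → ¬ δ C D → ¬ δ {x} D := by
      intro C D hC hCD hD
      obtain ⟨E, hE1, hE2⟩ := hδ.strong C D hCD
      by_cases hx : x ∈ E
      · exact hE1 (hδ.symm _ _ (hδ.mono_left (Set.singleton_subset_iff.2 hx) hC))
      · exact hE2 (hδ.mono_left (Set.singleton_subset_iff.2 hx) hD)
    refine ⟨fun A hA B hB => ?_, fun A hA => ?_, fun A B hAB => ?_⟩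
    · by_contra hAB
      exact key A B hA hAB hB
    · exact hδ.symm _ _ (hA {x} (hδ.of_inter _ _ ⟨x, rfl, rfl⟩))
    · exact ((hδ.union_left A B {x}).1 (hδ.symm _ _ hAB)).imp (hδ.symm _ _) (hδ.symm _ _)

end Smirnov

/-- The discrete extension of a coarse proximity `b`. -/
def discreteExtension {X : Type*} (b : Set X → Set X → Prop) (A B : Set X) : Prop :=
  (A ∩ B).Nonempty ∨ b A B

namespace IsCoarseProximity

theorem discreteExtension {X : Type*} [Bornology X] {b : Set X → Set X → Prop}
    (hb : IsCoarseProximity b) : IsSeparatedProximity (discreteExtension b) where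
  symm A B h := by
    rcases h with h | h
    · exact Or.inl (by rwa [Set.inter_comm])
    · exact Or.inr (hb.symm _ _ h)
  nonempty A B h := by
    rcases h with h | h
    · exact ⟨h.mono Set.inter_subset_left, h.mono Set.inter_subset_right⟩
    · obtain ⟨hA, hB⟩ := hb.unbounded A B h
      exact ⟨Bornology.nonempty_of_not_isBounded hA, Bornology.nonempty_of_not_isBounded hB⟩
  of_inter A B h := Or.inl h
  union_left A B C := by
    simp only [_root_.discreteExtension, Set.union_inter_distrib_right, Set.union_nonempty,
      hb.union_left]
    tauto
  strong A B h := by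
    have hdisj : ¬ (A ∩ B).Nonempty := fun h' => h (Or.inl h')
    have hnb : ¬ b A B := fun h' => h (Or.inr h')
    obtain ⟨E, hE1, hE2⟩ := hb.strong A B hnb
    have mono : ∀ {P Q R : Set X}, P ⊆ Q → b P R → b Q R := by
      intro P Q R hPQ hP
      rw [← Set.union_eq_self_of_subset_left hPQ]
      exact (hb.union_left P Q R).2 (Or.inl hP)
    refine ⟨(E \ A) ∪ B, ?_, ?_⟩
    · rintro (⟨x, hxA, hx⟩ | h')
      · rcases hx with hx | hx
        · exact hx.2 hxA
        · exact hdisj ⟨x, hxA, hx⟩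
      · rcases (hb.union_left _ _ _).1 (hb.symm _ _ h') with h1 | h1
        · exact hE1 (hb.symm _ _ (mono Set.sdiff_subset h1))
        · exact hnb (hb.symm _ _ h1)
    · rintro (⟨x, hx, hxB⟩ | h')
      · exact hx (Or.inr hxB)
      · have hsub : ((E \ A) ∪ B)ᶜ ⊆ Eᶜ ∪ A := by
          intro x hx
          by_cases hxA : x ∈ A
          · exact Or.inr hxA
          · exact Or.inl fun hxE => hx (Or.inl ⟨hxE, hxA⟩)
        rcases (hb.union_left _ _ _).1 (mono hsub h') with h1 | h1
        · exact hE2 h1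
        · exact hnb h1
  separated x y h := by
    rcases h with ⟨z, hz1, hz2⟩ | h
    · exact (Set.mem_singleton_iff.1 hz1).symm.trans (Set.mem_singleton_iff.1 hz2)
    · exact absurd Bornology.isBounded_singleton (hb.unbounded _ _ h).1

/-- The boundary `𝒰X`: the clusters of the discrete extension that contain only unbounded sets,
as a subspace of the Smirnov compactification. -/
def boundary {X : Type*} [Bornology X] {b : Set X → Set X → Prop}
    (hb : IsCoarseProximity b) : Set (Smirnov hb.discreteExtension) :=
  {σ | ∀ A ∈ σ.sets, ¬ Bornology.IsBounded A}

/-- The trace `A'` of `A ⊆ X` on the boundary: the part in `𝒰X` of the closure of `A` in the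
Smirnov compactification. -/
def trace {X : Type*} [Bornology X] {b : Set X → Set X → Prop}
    (hb : IsCoarseProximity b) (A : Set X) : Set hb.boundary :=
  Subtype.val ⁻¹' closure (Smirnov.point hb.discreteExtension '' A)

end IsCoarseProximity

/-- `S` is a subset of a finite union of bounded sets of `X` and bounded sets of `Y`. -/
def IsSumBounded {X Y : Type*} [Bornology X] [Bornology Y] (S : Set (X ⊕ Y)) : Prop :=
  ∃ F : Set (Set (X ⊕ Y)), F.Finite ∧
    (∀ C ∈ F, (∃ A : Set X, Bornology.IsBounded A ∧ C = Sum.inl '' A) ∨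
      (∃ B : Set Y, Bornology.IsBounded B ∧ C = Sum.inr '' B)) ∧
    S ⊆ ⋃₀ F

/-- The bornology on the disjoint union generated by the two bornologies. -/
instance Sum.instBornology {X Y : Type*} [Bornology X] [Bornology Y] : Bornology (X ⊕ Y) :=
  Bornology.ofBounded {S | IsSumBounded S}
    ⟨∅, Set.finite_empty, by simp, by simp⟩
    (fun S ⟨F, hF, hF', hS⟩ T hT => ⟨F, hF, hF', hT.trans hS⟩)
    (fun S ⟨F, hF, hF', hS⟩ T ⟨G, hG, hG', hT⟩ =>
      ⟨F ∪ G, hF.union hG, fun C hC => hC.elim (hF' C) (hG' C), by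
        rw [Set.sUnion_union]
        exact Set.union_subset_union hS hT⟩)
    (fun z => by
      rcases z with x | y
      · exact ⟨{{Sum.inl x}}, Set.finite_singleton _, by
          rintro C rfl
          exact Or.inl ⟨{x}, Bornology.isBounded_singleton, by simp⟩, by simp⟩
      · exact ⟨{{Sum.inr y}}, Set.finite_singleton _, by
          rintro C rfl
          exact Or.inr ⟨{y}, Bornology.isBounded_singleton, by simp⟩, by simp⟩)

/-- The set `A'_X ∪ g(A'_Y)` in `𝒰X`, for `A ⊆ X ⊔ Y`. -/
def stitchTrace {X Y : Type*} [Bornology X] [Bornology Y]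
    {bX : Set X → Set X → Prop} {bY : Set Y → Set Y → Prop}
    (hX : IsCoarseProximity bX) (hY : IsCoarseProximity bY)
    (g : hY.boundary ≃ₜ hX.boundary) (A : Set (X ⊕ Y)) : Set hX.boundary :=
  hX.trace (Sum.inl ⁻¹' A) ∪ g '' hY.trace (Sum.inr ⁻¹' A)

/-- The relation `b_g` on the subsets of `X ⊔ Y`; bounded sets are related to nothing. -/
def stitchRel {X Y : Type*} [Bornology X] [Bornology Y]
    {bX : Set X → Set X → Prop} {bY : Set Y → Set Y → Prop}
    (hX : IsCoarseProximity bX) (hY : IsCoarseProximity bY)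
    (g : hY.boundary ≃ₜ hX.boundary) (A B : Set (X ⊕ Y)) : Prop :=
  ¬ Bornology.IsBounded A ∧ ¬ Bornology.IsBounded B ∧
    (stitchTrace hX hY g A ∩ stitchTrace hX hY g B).Nonempty

/-!
The proof describes all topologies involved by their basic closed sets. In the Smirnov
compactification `𝔛` of a separated proximity, the closure of `A ⊆ X` is the set of clusters that
contain `A` (`Smirnov.closure_image_point`), and by definition of the topology a point outside a
closed set is separated from it by a set of this form. Compactness of `𝔛` comes from an
ultrafilter argument: a family of pairwise near sets that is prime for unions extends to a
cluster (`Smirnov.ofPrime`), and the sets whose closures belong to an ultrafilter on `𝔛` form such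
a family. The boundary is closed in `𝔛`, hence compact. An ultrafilter on `X` that contains the
cobounded sets is another such family, so unbounded sets have nonempty trace.

Write `S A = A'_X ∪ g(A'_Y)`. The key point is that disjoint closed sets `K`, `L` of the boundary
of `X` are separated by some `E ⊆ X ⊔ Y`, in the sense that `S E` misses `K` and `S Eᶜ` misses `L`
(`exists_separating_stitchTrace`): separate `K` from `L` by a subset of `X`, separate their
preimages under `g` by a subset of `Y`, and take the disjoint union. Applied to `K = S A` and
`L = S B`, this is the strong axiom for `b_g`; the other axioms follow from `S (A ∪ B) = S A ∪ S B`
and from `S A = ∅` exactly when `A` is bounded.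

The homeomorphism sends `σ` in the boundary of `X` to the cluster `{A | σ ∈ S A}`. Applied to a
point and `S A`, separation shows that this is a cluster. By compactness the sets `S A`, with `A` in
a given boundary cluster `ρ` of `X ⊔ Y`, have a common point, which is then mapped to `ρ`. Finally
the preimage of the trace of `A` is the closed set `S A`, and the image of the trace of `A ⊆ X` is
the trace of `A` viewed as a subset of `X ⊔ Y`, so that the bijection is bicontinuous.
-/

open Set

/-! ### Clusters and the topology of the Smirnov compactification -/

namespace Smirnov

variable {X : Type*} {δ : Set X → Set X → Prop} {hδ : IsSeparatedProximity δ}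

theorem mem_mono (σ : Smirnov hδ) {A B : Set X} (hA : A ∈ σ.sets) (h : A ⊆ B) : B ∈ σ.sets :=
  σ.isCluster.mem_of_subset hδ hA h

theorem empty_notMem (σ : Smirnov hδ) : (∅ : Set X) ∉ σ.sets := fun h =>
  not_nonempty_empty (hδ.nonempty _ _ (σ.isCluster.near _ h _ h)).1

theorem union_mem_iff (σ : Smirnov hδ) {A B : Set X} :
    A ∪ B ∈ σ.sets ↔ A ∈ σ.sets ∨ B ∈ σ.sets :=
  ⟨σ.isCluster.union A B, fun h => h.elim (fun h => σ.mem_mono h subset_union_left)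
    (fun h => σ.mem_mono h subset_union_right)⟩

theorem exists_far_of_notMem (σ : Smirnov hδ) {A : Set X} (hA : A ∉ σ.sets) :
    ∃ C ∈ σ.sets, ¬ δ A C := by
  by_contra! h
  exact hA (σ.isCluster.mem_of_near A h)

/-- Clusters are maximal: nested clusters are equal. -/
theorem eq_of_subset {σ τ : Smirnov hδ} (h : σ.sets ⊆ τ.sets) : σ = τ :=
  Smirnov.ext (h.antisymm fun B hB => σ.isCluster.mem_of_near B fun C hC =>
    τ.isCluster.near B hB C (h hC))

theorem isClosed_setOf_mem (A : Set X) : IsClosed {σ : Smirnov hδ | A ∈ σ.sets} := by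
  refine ⟨fun σ hσ h => hσ ?_⟩
  rw [near_singleton_iff] at h
  exact h A fun τ hτ => by simpa using hτ

instance : T1Space (Smirnov hδ) := by
  refine ⟨fun σ => ?_⟩
  have h : {σ} = ⋂ A ∈ σ.sets, {τ : Smirnov hδ | A ∈ τ.sets} := by
    ext τ
    simp only [mem_singleton_iff, mem_iInter, mem_ofPred_eq]
    exact ⟨by rintro rfl A hA; exact hA, fun h => (eq_of_subset h).symm⟩
  rw [h]
  exact isClosed_biInter fun A _ => isClosed_setOf_mem A

theorem exists_absorbs_of_isClosed {F : Set (Smirnov hδ)} (hF : IsClosed F) {σ : Smirnov hδ}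
    (hσ : σ ∉ F) : ∃ A, Absorbs A F ∧ A ∉ σ.sets := by
  have h := hF.isOpen_compl σ hσ
  rw [near_singleton_iff, compl_compl] at h
  push Not at h
  exact h

/-- The closure of `A` in the compactification is the set of clusters that contain `A`. -/
theorem closure_image_point (A : Set X) :
    closure (point hδ '' A) = {σ : Smirnov hδ | A ∈ σ.sets} := by
  refine Subset.antisymm (closure_minimal ?_ (isClosed_setOf_mem A)) fun σ hσ => ?_
  · rintro _ ⟨x, hx, rfl⟩
    exact hδ.of_inter _ _ ⟨x, rfl, hx⟩
  · by_contra hcl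
    obtain ⟨B, hB, hBσ⟩ := exists_absorbs_of_isClosed isClosed_closure hcl
    obtain ⟨C, hC, hBC⟩ := σ.exists_far_of_notMem hBσ
    obtain ⟨E, hBE, hEC⟩ := hδ.strong _ _ hBC
    refine hEC (hδ.mono_left (fun x hxA hxE => hBE ?_) (σ.isCluster.near A hσ C hC))
    exact hδ.symm _ _ (hδ.mono_left (singleton_subset_iff.2 hxE)
      (hB _ (subset_closure ⟨x, hxA, rfl⟩)))

/-- The cluster of all sets near to every member of `P`, where `P` is a family of pairwise near
sets that contains the whole space and is prime for unions. -/
def ofPrime (hδ : IsSeparatedProximity δ) (P : Set (Set X)) (huniv : univ ∈ P)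
    (hnear : ∀ A ∈ P, ∀ B ∈ P, δ A B) (hunion : ∀ A B, A ∪ B ∈ P → A ∈ P ∨ B ∈ P) :
    Smirnov hδ where
  sets := {A | ∀ C ∈ P, δ A C}
  isCluster := by
    refine ⟨fun A hA B hB => ?_, fun A hA C hC => hA C (hnear C hC), fun A B hAB => ?_⟩
    · by_contra hfar
      obtain ⟨E, hE, hE'⟩ := hδ.strong _ _ hfar
      rcases hunion E Eᶜ (by rwa [union_compl_self]) with h | h
      · exact hE (hA E h)
      · exact hE' (hδ.symm _ _ (hB _ h))
    · by_contra! h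
      simp only [mem_ofPred_eq, not_forall] at h
      obtain ⟨⟨C, hC, hAC⟩, D, hD, hBD⟩ := h
      -- `P` need not be closed under intersections, but `E ∩ F` below belongs to `P`, since
      -- `Eᶜ` and `Fᶜ` do not.
      obtain ⟨E, hAE, hEC⟩ := hδ.strong _ _ hAC
      obtain ⟨F, hBF, hFD⟩ := hδ.strong _ _ hBD
      rcases hunion (E ∩ F) (E ∩ F)ᶜ (by rwa [union_compl_self]) with h | h
      · rcases (hδ.union_left _ _ _).1 (hAB _ h) with h' | h'
        · exact hAE (hδ.symm _ _ (hδ.mono_left inter_subset_left (hδ.symm _ _ h')))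
        · exact hBF (hδ.symm _ _ (hδ.mono_left inter_subset_right (hδ.symm _ _ h')))
      · rw [compl_inter] at h
        exact (hunion _ _ h).elim (fun h => hEC (hnear _ h C hC)) fun h => hFD (hnear _ h D hD)

instance : CompactSpace (Smirnov hδ) := by
  refine ⟨isCompact_iff_ultrafilter_le_nhds.2 fun U _ => ?_⟩
  let P : Set (Set X) := {C | {τ : Smirnov hδ | C ∈ τ.sets} ∈ U}
  have hnear : ∀ A ∈ P, ∀ B ∈ P, δ A B := fun A hA B hB => by
    obtain ⟨τ, hτA, hτB⟩ := U.nonempty_of_mem (Filter.inter_mem hA hB)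
    exact τ.isCluster.near A hτA B hτB
  have huniv : univ ∈ P := by
    refine Filter.mem_of_superset Filter.univ_mem fun τ _ => ?_
    refine τ.isCluster.mem_of_near _ fun C hC => ?_
    exact hδ.mono_left (subset_univ C) (τ.isCluster.near C hC C hC)
  refine ⟨ofPrime hδ P huniv hnear fun A B h => ?_, mem_univ _, fun V hV => ?_⟩
  · refine Ultrafilter.union_mem_iff.1 (Filter.mem_of_superset h fun τ hτ => ?_)
    exact τ.union_mem_iff.1 hτ
  · obtain ⟨W, hWV, hW, hσW⟩ := mem_nhds_iff.1 hV
    obtain ⟨A, hA, hAσ⟩ := exists_absorbs_of_isClosed hW.isClosed_compl (notMem_compl_iff.2 hσW)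
    refine Filter.mem_of_superset (?_ : W ∈ U) hWV
    by_contra hWU
    refine hAσ (hnear A (Filter.mem_of_superset (Ultrafilter.compl_mem_iff_notMem.2 hWU) ?_))
    exact fun τ hτ => hA τ hτ

/-- Disjoint closed sets are separated by the closures of a set `E` and its complement. The cluster
axioms separate a point of `K` from `L`; compactness of `K` gives a finite intersection. -/
theorem exists_separating {K L : Set (Smirnov hδ)} (hK : IsClosed K) (hL : IsClosed L)
    (hKL : Disjoint K L) :
    ∃ E : Set X, (∀ σ ∈ K, E ∉ σ.sets) ∧ ∀ τ ∈ L, Eᶜ ∉ τ.sets := by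
  refine hK.isCompact.induction_on (p := fun K => ∃ E : Set X,
    (∀ σ ∈ K, E ∉ σ.sets) ∧ ∀ τ ∈ L, Eᶜ ∉ τ.sets) ?_ ?_ ?_ ?_
  · exact ⟨univ, by simp, fun τ _ => by simpa using τ.empty_notMem⟩
  · rintro s t hst ⟨E, hE, hE'⟩
    exact ⟨E, fun σ hσ => hE σ (hst hσ), hE'⟩
  · rintro s t ⟨E, hE, hE'⟩ ⟨F, hF, hF'⟩
    refine ⟨E ∩ F, fun σ hσ h => ?_, fun τ hτ h => ?_⟩
    · exact hσ.elim (fun hσ => hE σ hσ (σ.mem_mono h inter_subset_left))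
        fun hσ => hF σ hσ (σ.mem_mono h inter_subset_right)
    · rw [compl_inter] at h
      exact (τ.union_mem_iff.1 h).elim (hE' τ hτ) (hF' τ hτ)
  · intro σ hσ
    obtain ⟨C, hC, hCσ⟩ := exists_absorbs_of_isClosed hL (hKL.notMem_of_mem_left hσ)
    obtain ⟨D, hD, hCD⟩ := σ.exists_far_of_notMem hCσ
    obtain ⟨E, hE, hE'⟩ := hδ.strong _ _ fun h => hCD (hδ.symm D C h)
    refine ⟨{τ | E ∉ τ.sets}, mem_nhdsWithin_of_mem_nhds ?_, E, fun τ hτ => hτ, fun τ hτ h => ?_⟩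
    · exact (isClosed_setOf_mem E).isOpen_compl.mem_nhds fun h =>
        hE (σ.isCluster.near _ hD _ h)
    · exact hE' (τ.isCluster.near _ h _ (hC τ hτ))

end Smirnov

/-! ### The boundary of a coarse proximity space -/

namespace IsCoarseProximity

variable {X : Type*} [Bornology X] {b : Set X → Set X → Prop} (hb : IsCoarseProximity b)

theorem mem_trace {A : Set X} {σ : hb.boundary} : σ ∈ hb.trace A ↔ A ∈ σ.1.sets := by
  rw [trace, Smirnov.closure_image_point]
  rfl

theorem isClosed_trace (A : Set X) : IsClosed (hb.trace A) :=
  isClosed_closure.preimage continuous_subtype_val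

theorem notMem_of_isBounded (σ : hb.boundary) {A : Set X} (hA : Bornology.IsBounded A) :
    A ∉ σ.1.sets := fun h => σ.2 A h hA

theorem mem_or_compl_mem (σ : hb.boundary) (A : Set X) : A ∈ σ.1.sets ∨ Aᶜ ∈ σ.1.sets := by
  rw [← σ.1.union_mem_iff, union_compl_self]
  refine σ.1.isCluster.mem_of_near _ fun C hC => ?_
  exact hb.discreteExtension.mono_left (subset_univ C) (σ.1.isCluster.near C hC C hC)

theorem isClosed_boundary : IsClosed hb.boundary := by
  have h : hb.boundary = ⋂ (A : Set X) (_ : Bornology.IsBounded A),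
      {σ : Smirnov hb.discreteExtension | Aᶜ ∈ σ.sets} := by
    ext σ
    simp only [mem_iInter, mem_ofPred_eq]
    refine ⟨fun hσ A hA => ?_, fun hσ A hAσ hA => ?_⟩
    · exact (hb.mem_or_compl_mem ⟨σ, hσ⟩ A).resolve_left (hb.notMem_of_isBounded ⟨σ, hσ⟩ hA)
    · rcases σ.isCluster.near A hAσ _ (hσ A hA) with h | h
      · simp at h
      · exact (hb.unbounded _ _ h).1 hA
  rw [h]
  exact isClosed_iInter fun A => isClosed_iInter fun _ => Smirnov.isClosed_setOf_mem _

instance : CompactSpace hb.boundary :=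
  isCompact_iff_compactSpace.1 hb.isClosed_boundary.isCompact

/-- Members of a boundary cluster are related by the coarse proximity itself: a bounded
intersection can be removed. -/
theorem rel_of_mem (σ : hb.boundary) {A B : Set X} (hA : A ∈ σ.1.sets) (hB : B ∈ σ.1.sets) :
    b A B := by
  by_contra h
  have hAB : Bornology.IsBounded (A ∩ B) := by
    by_contra h'
    exact h (hb.of_inter _ _ h')
  rw [← inter_union_sdiff A B, σ.1.union_mem_iff] at hA
  rcases σ.1.isCluster.near _ (hA.resolve_left (hb.notMem_of_isBounded σ hAB)) _ hB with h' | h'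
  · simp at h'
  · rw [← inter_union_sdiff A B] at h
    exact h ((hb.union_left _ _ _).2 (Or.inr h'))

/-- The trace contains the cluster of any ultrafilter on `A` that is finer than the cobounded
filter. -/
theorem trace_nonempty {A : Set X} (hA : ¬ Bornology.IsBounded A) : (hb.trace A).Nonempty := by
  have hne : (Bornology.cobounded X ⊓ Filter.principal A).NeBot := by
    rw [Filter.inf_principal_neBot_iff]
    intro U hU
    by_contra h
    refine hA (Bornology.IsBounded.subset (t := Uᶜ) ?_ ?_)
    · rwa [Bornology.isBounded_def, compl_compl]
    · exact fun x hx hxU => h ⟨x, hxU, hx⟩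
  let u := Ultrafilter.of (Bornology.cobounded X ⊓ Filter.principal A)
  have hu : ↑u ≤ Bornology.cobounded X ⊓ Filter.principal A := Ultrafilter.of_le _
  have hnear : ∀ C ∈ u, ∀ D ∈ u, _root_.discreteExtension b C D := fun C hC D hD =>
    Or.inl (u.nonempty_of_mem (Filter.inter_mem hC hD))
  let σ := Smirnov.ofPrime hb.discreteExtension {C | C ∈ u} Filter.univ_mem hnear
    fun C D => Ultrafilter.union_mem_iff.1
  refine ⟨⟨σ, fun C hC hCb => ?_⟩, hb.mem_trace.2 (hnear A ?_)⟩
  · rcases hC Cᶜ (hu (Filter.mem_inf_of_left (Bornology.isBounded_def.1 hCb))) with h | h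
    · simp at h
    · exact (hb.unbounded _ _ h).1 hCb
  · exact hu (Filter.mem_inf_of_right (Filter.mem_principal_self A))

theorem exists_separating {K L : Set hb.boundary} (hK : IsClosed K) (hL : IsClosed L)
    (hKL : Disjoint K L) :
    ∃ E : Set X, (∀ σ ∈ K, E ∉ σ.1.sets) ∧ ∀ τ ∈ L, Eᶜ ∉ τ.1.sets := by
  have hcl := hb.isClosed_boundary.isClosedEmbedding_subtypeVal.isClosedMap
  obtain ⟨E, hE, hE'⟩ := Smirnov.exists_separating (hcl K hK) (hcl L hL)
    ((disjoint_image_iff Subtype.val_injective).2 hKL)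
  exact ⟨E, fun σ hσ => hE _ ⟨σ, hσ, rfl⟩, fun τ hτ => hE' _ ⟨τ, hτ, rfl⟩⟩

/-- A map into the boundary is continuous if the preimages of traces are closed. -/
theorem continuous_of_isClosed_preimage_trace {Z : Type*} [TopologicalSpace Z]
    {f : Z → hb.boundary} (h : ∀ A, IsClosed (f ⁻¹' hb.trace A)) : Continuous f := by
  refine continuous_induced_rng.2 (continuous_iff_isClosed.2 fun F hF => ?_)
  have hF' : Subtype.val ∘ f ⁻¹' F = ⋂ (A : Set X) (_ : Smirnov.Absorbs A F),
      f ⁻¹' hb.trace A := by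
    ext z
    simp only [mem_iInter, mem_preimage, mem_trace, Function.comp_apply]
    refine ⟨fun hz A hA => hA _ hz, fun hz => ?_⟩
    by_contra hzF
    obtain ⟨A, hA, hAz⟩ := Smirnov.exists_absorbs_of_isClosed hF hzF
    exact hAz (hz A hA)
  rw [hF']
  exact isClosed_iInter fun A => isClosed_iInter fun _ => h A

end IsCoarseProximity

/-! ### Stitching along a homeomorphism of boundaries -/

theorem Sum.isBounded_iff {X Y : Type*} [Bornology X] [Bornology Y] {S : Set (X ⊕ Y)} :
    Bornology.IsBounded S ↔
      Bornology.IsBounded (Sum.inl ⁻¹' S) ∧ Bornology.IsBounded (Sum.inr ⁻¹' S) := by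
  have hiff : Bornology.IsBounded S ↔ IsSumBounded S := Bornology.isBounded_ofBounded_iff _
  rw [hiff]
  constructor
  · rintro ⟨F, hF, hF', hS⟩
    constructor
    · refine ((Bornology.isBounded_biUnion hF (f := fun C => Sum.inl ⁻¹' C)).2 ?_).subset
        ((preimage_mono hS).trans (by rw [preimage_sUnion]))
      intro C hC
      rcases hF' C hC with ⟨A, hA, rfl⟩ | ⟨B, -, rfl⟩
      · rwa [preimage_image_eq _ Sum.inl_injective]
      · simp
    · refine ((Bornology.isBounded_biUnion hF (f := fun C => Sum.inr ⁻¹' C)).2 ?_).subset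
        ((preimage_mono hS).trans (by rw [preimage_sUnion]))
      intro C hC
      rcases hF' C hC with ⟨A, -, rfl⟩ | ⟨B, hB, rfl⟩
      · simp
      · rwa [preimage_image_eq _ Sum.inr_injective]
  · rintro ⟨hl, hr⟩
    refine ⟨{Sum.inl '' (Sum.inl ⁻¹' S), Sum.inr '' (Sum.inr ⁻¹' S)}, by simp, ?_, ?_⟩
    · rintro C (rfl | rfl)
      · exact Or.inl ⟨_, hl, rfl⟩
      · exact Or.inr ⟨_, hr, rfl⟩
    · rw [sUnion_pair, image_preimage_inl_union_image_preimage_inr]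

section Stitching

variable {X Y : Type*} [Bornology X] [Bornology Y]
  {bX : Set X → Set X → Prop} {bY : Set Y → Set Y → Prop}
  (hX : IsCoarseProximity bX) (hY : IsCoarseProximity bY) (g : hY.boundary ≃ₜ hX.boundary)

theorem mem_stitchTrace {A : Set (X ⊕ Y)} {σ : hX.boundary} :
    σ ∈ stitchTrace hX hY g A ↔
      Sum.inl ⁻¹' A ∈ σ.1.sets ∨ Sum.inr ⁻¹' A ∈ (g.symm σ).1.sets := by
  rw [stitchTrace, mem_union, hX.mem_trace, g.image_eq_preimage_symm, mem_preimage,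
    hY.mem_trace]

theorem isClosed_stitchTrace (A : Set (X ⊕ Y)) : IsClosed (stitchTrace hX hY g A) :=
  (hX.isClosed_trace _).union (g.isClosedMap _ (hY.isClosed_trace _))

theorem stitchTrace_union (A B : Set (X ⊕ Y)) :
    stitchTrace hX hY g (A ∪ B) = stitchTrace hX hY g A ∪ stitchTrace hX hY g B := by
  ext σ
  simp only [mem_union, mem_stitchTrace, preimage_union, Smirnov.union_mem_iff]
  tauto

theorem stitchTrace_mono {A B : Set (X ⊕ Y)} (h : A ⊆ B) :
    stitchTrace hX hY g A ⊆ stitchTrace hX hY g B := by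
  rw [← union_eq_self_of_subset_left h, stitchTrace_union]
  exact subset_union_left

theorem stitchTrace_nonempty_iff {A : Set (X ⊕ Y)} :
    (stitchTrace hX hY g A).Nonempty ↔ ¬ Bornology.IsBounded A := by
  rw [Sum.isBounded_iff]
  constructor
  · rintro ⟨σ, hσ⟩ ⟨hl, hr⟩
    exact ((mem_stitchTrace hX hY g).1 hσ).elim (hX.notMem_of_isBounded σ hl)
      (hY.notMem_of_isBounded _ hr)
  · intro h
    by_cases hl : Bornology.IsBounded (Sum.inl ⁻¹' A)
    · exact ((hY.trace_nonempty fun hr => h ⟨hl, hr⟩).image g).mono subset_union_right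
    · exact (hX.trace_nonempty hl).mono subset_union_left

theorem mem_stitchTrace_or_compl (σ : hX.boundary) (A : Set (X ⊕ Y)) :
    σ ∈ stitchTrace hX hY g A ∨ σ ∈ stitchTrace hX hY g Aᶜ := by
  simp only [mem_stitchTrace]
  exact (hX.mem_or_compl_mem σ (Sum.inl ⁻¹' A)).imp Or.inl Or.inl

/-- Unboundedness is automatic when the traces meet, since bounded sets have empty trace. -/
theorem stitchRel_iff {A B : Set (X ⊕ Y)} :
    stitchRel hX hY g A B ↔ (stitchTrace hX hY g A ∩ stitchTrace hX hY g B).Nonempty :=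
  ⟨fun h => h.2.2, fun h => ⟨(stitchTrace_nonempty_iff hX hY g).1 h.left,
    (stitchTrace_nonempty_iff hX hY g).1 h.right, h⟩⟩

/-- Separation in the stitched space: `E` is the disjoint union of a separating set for `K`, `L` in
`X` and one for their preimages under `g` in `Y`. -/
theorem exists_separating_stitchTrace {K L : Set hX.boundary} (hK : IsClosed K) (hL : IsClosed L)
    (hKL : Disjoint K L) :
    ∃ E : Set (X ⊕ Y), Disjoint K (stitchTrace hX hY g E) ∧
      Disjoint (stitchTrace hX hY g Eᶜ) L := by
  obtain ⟨E, hE, hE'⟩ := hX.exists_separating hK hL hKL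
  obtain ⟨F, hF, hF'⟩ := hY.exists_separating (hK.preimage g.continuous)
    (hL.preimage g.continuous) (hKL.preimage g)
  refine ⟨{z | Sum.elim (· ∈ E) (· ∈ F) z}, disjoint_left.2 fun σ hσ h => ?_,
    disjoint_right.2 fun σ hσ h => ?_⟩
  · exact ((mem_stitchTrace hX hY g).1 h).elim (hE σ hσ) (hF (g.symm σ) (by simpa using hσ))
  · exact ((mem_stitchTrace hX hY g).1 h).elim (hE' σ hσ) (hF' (g.symm σ) (by simpa using hσ))

theorem isCoarseProximity_stitchRel : IsCoarseProximity (stitchRel hX hY g) where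
  symm A B h := by
    rw [stitchRel_iff] at h ⊢
    rwa [inter_comm]
  unbounded A B h := ⟨h.1, h.2.1⟩
  of_inter A B h := (stitchRel_iff hX hY g).2
    (((stitchTrace_nonempty_iff hX hY g).2 h).mono (subset_inter
      (stitchTrace_mono hX hY g inter_subset_left) (stitchTrace_mono hX hY g inter_subset_right)))
  union_left A B C := by
    simp only [stitchRel_iff, stitchTrace_union, union_inter_distrib_right, union_nonempty]
  strong A B h := by
    simp only [stitchRel_iff, ← disjoint_iff_inter_eq_empty, not_nonempty_iff_eq_empty] at h ⊢
    exact exists_separating_stitchTrace hX hY g (isClosed_stitchTrace hX hY g A)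
      (isClosed_stitchTrace hX hY g B) h

/-- The boundary cluster of `X ⊔ Y` at a boundary point `σ` of `X`: it consists of the sets `A`
with `σ ∈ A'_X ∪ g(A'_Y)`. -/
def stitchCluster (σ : hX.boundary) : (isCoarseProximity_stitchRel hX hY g).boundary where
  val :=
    { sets := {A | σ ∈ stitchTrace hX hY g A}
      isCluster := by
        refine ⟨fun A hA B hB => Or.inr ((stitchRel_iff hX hY g).2 ⟨σ, hA, hB⟩), fun A hA => ?_,
          fun A B h => ?_⟩
        · by_contra hσ
          obtain ⟨E, hE, hE'⟩ := exists_separating_stitchTrace hX hY g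
            isClosed_singleton (isClosed_stitchTrace hX hY g A) (disjoint_singleton_left.2 hσ)
          have hEc := (mem_stitchTrace_or_compl hX hY g σ E).resolve_left
            (disjoint_singleton_left.1 hE)
          -- `Eᶜ \ A` is a member of the family, but it is disjoint from `A` and not related to it.
          rw [← inter_union_sdiff Eᶜ A, stitchTrace_union] at hEc
          have hC := hEc.resolve_left fun h => hσ (stitchTrace_mono hX hY g inter_subset_right h)
          rcases hA _ hC with h | h
          · simp at h
          · obtain ⟨τ, hτA, hτC⟩ := (stitchRel_iff hX hY g).1 h
            exact disjoint_left.1 hE' (stitchTrace_mono hX hY g sdiff_subset hτC) hτA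
        · rwa [mem_ofPred_eq, stitchTrace_union] at h }
  property A hA := (stitchTrace_nonempty_iff hX hY g).1 ⟨σ, hA⟩

theorem mem_trace_stitchCluster {A : Set (X ⊕ Y)} {σ : hX.boundary} :
    stitchCluster hX hY g σ ∈ (isCoarseProximity_stitchRel hX hY g).trace A ↔
      σ ∈ stitchTrace hX hY g A :=
  IsCoarseProximity.mem_trace _

theorem stitchTrace_image_inl (A : Set X) :
    stitchTrace hX hY g (Sum.inl '' A) = hX.trace A := by
  ext σ
  simp [mem_stitchTrace, hX.mem_trace, preimage_image_eq _ Sum.inl_injective,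
    Smirnov.empty_notMem]

theorem stitchCluster_injective : Function.Injective (stitchCluster hX hY g) := by
  refine fun σ τ h => Subtype.ext (Smirnov.eq_of_subset fun A hA => ?_)
  rwa [← hX.mem_trace, ← stitchTrace_image_inl hX hY g, ← mem_trace_stitchCluster, ← h,
    mem_trace_stitchCluster, stitchTrace_image_inl, hX.mem_trace]

/-- Any point common to all `stitchTrace A` with `A` in the cluster `ρ` is mapped to `ρ`, since
clusters are maximal. -/
theorem stitchCluster_surjective : Function.Surjective (stitchCluster hX hY g) := by
  intro ρ
  have hb := isCoarseProximity_stitchRel hX hY g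
  suffices h : ∃ σ, ∀ A ∈ ρ.1.sets, σ ∈ stitchTrace hX hY g A by
    obtain ⟨σ, hσ⟩ := h
    exact ⟨σ, Subtype.ext (Smirnov.eq_of_subset
      (σ := ρ.1) (τ := (stitchCluster hX hY g σ).1) fun A hA => hσ A hA).symm⟩
  by_contra! h
  -- Otherwise compactness yields a set `E` with empty `stitchTrace`, thus bounded, such that
  -- `Eᶜ` is not in `ρ` either.
  obtain ⟨E, hE, hE'⟩ := isCompact_univ.induction_on (p := fun s : Set hX.boundary =>
      ∃ E : Set (X ⊕ Y), Eᶜ ∉ ρ.1.sets ∧ Disjoint s (stitchTrace hX hY g E))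
    ⟨univ, by simpa using ρ.1.empty_notMem, empty_disjoint _⟩
    (fun s t hst ⟨E, hE, hE'⟩ => ⟨E, hE, hE'.mono_left hst⟩)
    (fun s t ⟨E, hE, hE'⟩ ⟨F, hF, hF'⟩ => ⟨E ∩ F, by
      rw [compl_inter, ρ.1.union_mem_iff]
      exact not_or.2 ⟨hE, hF⟩, disjoint_union_left.2
        ⟨hE'.mono_right (stitchTrace_mono hX hY g inter_subset_left),
          hF'.mono_right (stitchTrace_mono hX hY g inter_subset_right)⟩⟩)
    (fun σ _ => by
      obtain ⟨A, hA, hσA⟩ := h σ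
      obtain ⟨E, hE, hE'⟩ := exists_separating_stitchTrace hX hY g
        isClosed_singleton (isClosed_stitchTrace hX hY g A) (disjoint_singleton_left.2 hσA)
      refine ⟨(stitchTrace hX hY g E)ᶜ, mem_nhdsWithin_of_mem_nhds
        ((isClosed_stitchTrace hX hY g E).isOpen_compl.mem_nhds (disjoint_singleton_left.1 hE)),
        E, fun hEρ => ?_, disjoint_compl_left⟩
      exact not_disjoint_iff_nonempty_inter.2
        ((stitchRel_iff hX hY g).1 (hb.rel_of_mem ρ hEρ hA)) hE')
  have hEb : Bornology.IsBounded E := by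
    rw [← not_not (a := Bornology.IsBounded E), ← stitchTrace_nonempty_iff hX hY g,
      univ_disjoint.1 hE']
    exact not_nonempty_empty
  exact (hb.mem_or_compl_mem ρ E).elim (hb.notMem_of_isBounded ρ hEb) hE

/-- The homeomorphism `σ ↦ stitchCluster σ` from the boundary of `X` to the boundary of the
stitched space. -/
noncomputable def stitchHomeomorph :
    hX.boundary ≃ₜ (isCoarseProximity_stitchRel hX hY g).boundary where
  toEquiv := Equiv.ofBijective _
    ⟨stitchCluster_injective hX hY g, stitchCluster_surjective hX hY g⟩
  continuous_toFun := IsCoarseProximity.continuous_of_isClosed_preimage_trace _ fun A => by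
    convert isClosed_stitchTrace hX hY g A using 1
    ext σ
    exact mem_trace_stitchCluster hX hY g
  continuous_invFun := hX.continuous_of_isClosed_preimage_trace fun A => by
    convert (isCoarseProximity_stitchRel hX hY g).isClosed_trace (Sum.inl '' A) using 1
    ext ρ
    obtain ⟨σ, rfl⟩ := stitchCluster_surjective hX hY g ρ
    rw [mem_trace_stitchCluster, stitchTrace_image_inl, mem_preimage]
    exact iff_of_eq (congrArg (· ∈ hX.trace A) (Equiv.ofBijective_symm_apply_apply _
      ⟨stitchCluster_injective hX hY g,
      stitchCluster_surjective hX hY g⟩ σ))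

end Stitching

theorem mainTheorem2 {X Y : Type*} [Bornology X] [Bornology Y]
    {bX : Set X → Set X → Prop} {bY : Set Y → Set Y → Prop}
    (hX : IsCoarseProximity bX) (hY : IsCoarseProximity bY)
    (g : hY.boundary ≃ₜ hX.boundary) :
    ∃ hg : IsCoarseProximity (stitchRel hX hY g),
      Nonempty (hg.boundary ≃ₜ hX.boundary) :=
  ⟨isCoarseProximity_stitchRel hX hY g, ⟨(stitchHomeomorph hX hY g).symm⟩⟩
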